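/- Let $p<q<r$ be integers greater than $1$ and $n=pqr$. Put $H=\gcd(p-1,q-1,r-1)$ and $B=(q-1)/H$. (a) Suppose that $n=pqr$ is a Korselt number with three factors ($K_3N$); that is, $p,q,r$ are odd (not necessarily prime), each of $p-1$, $q-1$, $r-1$ divides $n-1$, and the integer $E=\dfrac{pq-1}{r-1}$ satisfies $E\ge 2$. Then $$B<\sqrt2\,\sqrt[4]{n}-\Bigl(\sqrt3-\frac12\Bigr)\sqrt[8]{\frac n4}+\frac{39+\sqrt3}{24}.$$ (b) Suppose that $p,q,r$ are primes and that $n=pqr$ is a Carmichael number ($C_3N$); that is, $n$ is composite and $a^n\equiv a\pmod n$ for all integers $a$. If $n\ne 6601$, then $$B<\sqrt2\,\sqrt[4]{n}-\Bigl(\sqrt7-\frac12\Bigr)\sqrt[8]{\frac n4}+\frac{175-3\sqrt7}{56}.$$ -/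

import Mathlib

/-- The number `E = (pq - 1) / (r - 1)` attached to three factors `p < q < r`; the division is exact
whenever `r - 1` divides `pqr - 1`. -/
def korseltE (p q r : ℕ) : ℕ := (p * q - 1) / (r - 1)

/-- The triple `(p, q, r)` is the Korselt factorisation of a Korselt number with three factors:
the not necessarily prime factors satisfy `1 < p < q < r`, are odd, each of `p - 1`, `q - 1`,
`r - 1` divides `pqr - 1`, and `E ≥ 2`. -/
structure IsKorselt3 (p q r : ℕ) : Prop where
  one_lt : 1 < p
  p_lt_q : p < q
  q_lt_r : q < r
  odd_p : Odd p
  odd_q : Odd q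
  odd_r : Odd r
  dvd_p : p - 1 ∣ p * q * r - 1
  dvd_q : q - 1 ∣ p * q * r - 1
  dvd_r : r - 1 ∣ p * q * r - 1
  two_le_E : 2 ≤ korseltE p q r

/-- A Carmichael number: a composite `n` such that `a ^ n ≡ a (mod n)` for all integers `a`. -/
def IsCarmichael (n : ℕ) : Prop :=
  1 < n ∧ ¬ n.Prime ∧ ∀ a : ℤ, a ^ n ≡ a [ZMOD n]

/-- `H = gcd (p - 1, q - 1, r - 1)`. -/
def korseltH (p q r : ℕ) : ℕ := Nat.gcd (p - 1) (Nat.gcd (q - 1) (r - 1))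

/-- `B = (q - 1) / H`, where the division is exact. -/
def korseltB (p q r : ℕ) : ℕ := (q - 1) / korseltH p q r

/-! ### Diophantine equations for the extremal triples -/

/-! Write `p, q, r` as `HA + 1, HB + 1, HC + 1`. The divisibilities give `kB = HA + E + 1` with `E ≤
HA`, and `A ∣ H + k`. Hence `kB < 2p`, while `A ≤ H + k`. Apart from the extremal case `k = 1`, `A =
H + 1`, this yields `B⁴ ≤ (1024/625) n` (`KorseltData.pow_le_of_two_le`,
`KorseltData.pow_le_of_one`), which is stronger than both bounds.

Extremal triples are parametrised by integers `H, t, m` with `m (H² + H - t) = (t + 1)² + H + 1`.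
For fixed `m`, both `B` and `n` are functions of `H`, and `boundFun √m` is the expansion of `B` in
`y = (n/4)^(1/8)` down to the constant term. For fixed `H`, a larger `m` lowers `B` and raises `n`,
so only small `m` must be excluded: `m = 1, 2` have no solutions, and `m = 3, …, 6` give no three
primes except those of 6601. The Diophantine lemmas are named after `m`. -/

theorem no_solution_one {h t : ℤ} (ht : 0 ≤ t) (hh : 0 ≤ h) : t ^ 2 + 3 * t + 2 ≠ h ^ 2 := by
  intro e
  have h1 : t + 1 < h := by nlinarith
  have h2 : h < t + 2 := by nlinarith
  omega

theorem no_solution_two (h t : ℤ) : t ^ 2 + 4 * t + 2 + h ≠ 2 * h ^ 2 + 2 * h := by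
  intro e
  have key : ∀ a b : ZMod 9, b ^ 2 + 4 * b + 2 + a ≠ 2 * a ^ 2 + 2 * a := by decide
  apply key (h : ZMod 9) (t : ZMod 9)
  exact_mod_cast congrArg (Int.cast : ℤ → ZMod 9) e

theorem solution_four {h t : ℤ} (ht : 0 ≤ t) (hh : 0 ≤ h)
    (e : t ^ 2 + 6 * t + 2 + h = 4 * h ^ 2 + 4 * h) : h = 6 ∧ t = 10 := by
  have h1 : 2 * h < t + 3 := by nlinarith
  have h2 : t + 3 < 2 * h + 3 := by nlinarith
  obtain h3 | h3 : t = 2 * h - 2 ∨ t = 2 * h - 1 := by omega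
  · subst h3
    have : h = 6 := by nlinarith
    omega
  · subst h3
    have : 5 * h = 3 := by nlinarith
    omega

theorem no_solution_five (h t : ℤ) : t ^ 2 + 7 * t + 2 + h ≠ 5 * h ^ 2 + 5 * h := by
  intro e
  have key : ∀ a b : ZMod 7, b ^ 2 + 7 * b + 2 + a = 5 * a ^ 2 + 5 * a → a = 1 ∧ b = 0 := by
    decide
  obtain ⟨h1, h2⟩ := key (h : ZMod 7) (t : ZMod 7)
    (by exact_mod_cast congrArg (Int.cast : ℤ → ZMod 7) e)
  have h1' : (7 : ℤ) ∣ h - 1 := by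
    rw [← Int.cast_one, ← sub_eq_zero, ← Int.cast_sub] at h1
    exact (ZMod.intCast_zmod_eq_zero_iff_dvd _ 7).1 h1
  have h2' : (7 : ℤ) ∣ t := (ZMod.intCast_zmod_eq_zero_iff_dvd _ 7).1 h2
  obtain ⟨a, ha⟩ := h1'
  obtain ⟨b, rfl⟩ := h2'
  obtain rfl : h = 7 * a + 1 := by omega
  -- The equation now fails modulo 49.
  ring_nf at e
  omega

/-- Pell descent by the unit `49 + 20√6`; the shift comes from `24T² = (12h + 5)² + 311`, and the
parity of `h` is preserved. Parity is essential, since `(h, T) = (1, 5)` is a solution. -/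
theorem no_solution_six_aux (n : ℕ) :
    ∀ h T : ℤ, 0 ≤ h → 0 ≤ T → h.toNat = n → Even h → T ^ 2 ≠ 6 * h ^ 2 + 5 * h + 14 := by
  induction n using Nat.strong_induction_on with
  | _ n ih =>
    intro h T hh hT hn hev e
    by_cases hs : h ≤ 72
    · have key : ∀ a < 37, ∀ b < 182, b ^ 2 ≠ 24 * a ^ 2 + 10 * a + 14 := by decide +kernel
      obtain ⟨c, hc⟩ := hev
      have hT' : T < 182 := by nlinarith
      lift T to ℕ using hT
      lift c to ℕ using (by omega)
      apply key c (by omega) T (by omega)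
      have : (T : ℤ) ^ 2 = 24 * (c : ℤ) ^ 2 + 10 * c + 14 := by rw [e, hc]; ring
      exact_mod_cast this
    · push Not at hs
      have u1 : 20 * T < 49 * h + 21 := by nlinarith
      have u2 : 48 * h + 20 < 20 * T := by nlinarith
      have u3 : 120 * h + 49 < 49 * T := by nlinarith
      refine ih (49 * h - 20 * T + 20).toNat (by omega) (49 * h - 20 * T + 20)
        (49 * T - 120 * h - 50) (by omega) (by omega) rfl ?_ ?_
      · obtain ⟨c, hc⟩ := hev
        exact ⟨49 * c - 10 * T + 10, by rw [hc]; ring⟩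
      · linear_combination e

theorem no_solution_six {h t : ℤ} (ht : 0 ≤ t) (hh : 0 ≤ h) (hev : Even h) :
    t ^ 2 + 8 * t + 2 + h ≠ 6 * h ^ 2 + 6 * h := by
  intro e
  exact no_solution_six_aux _ h (t + 4) hh (by omega) rfl hev (by linear_combination e)

/-- The orbit modulo `21` of the solution `(2, 2)` of the equation in `solution_three_mod`. -/
def orbitTwoTwo : List (ZMod 21 × ZMod 21) :=
  [(2, 2), (13, 15), (16, 7), (5, 8), (16, 9), (13, 1), (2, 14), (19, 15), (16, 16), (20, 8),
    (16, 0), (19, 1)]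

set_option maxRecDepth 4000 in
-- There are infinitely many solutions, but descent by the unit `7 + 4√3` takes every one with `h`
-- even back to `(2, 2)`. The inverse step permutes the finite orbit modulo 21.
theorem solution_three_mod (n : ℕ) :
    ∀ h t : ℤ, 0 ≤ h → 0 ≤ t → h.toNat = n → Even h →
      t ^ 2 + 5 * t + 2 + h = 3 * h ^ 2 + 3 * h → ((h : ZMod 21), (t : ZMod 21)) ∈ orbitTwoTwo := by
  induction n using Nat.strong_induction_on with
  | _ n ih =>
    intro h t hh ht hn hev e
    by_cases hs : h ≤ 8
    · have ht' : t < 15 := by nlinarith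
      have : h = 2 ∧ t = 2 := by
        obtain ⟨c, hc⟩ := hev
        have hc1 : 0 ≤ c := by omega
        have hc2 : c ≤ 4 := by omega
        interval_cases c <;> subst hc
        · nlinarith
        · refine ⟨rfl, ?_⟩
          nlinarith
        all_goals (exfalso; interval_cases t <;> omega)
      obtain ⟨rfl, rfl⟩ := this
      decide
    · push Not at hs
      have u1 : 4 * t < 7 * h - 7 := by nlinarith
      have u2 : 6 * h - 8 < 4 * t := by nlinarith
      have u3 : 12 * h - 12 < 7 * t := by nlinarith
      have := ih (7 * h - 4 * t - 8).toNat (by omega) (7 * h - 4 * t - 8)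
        (7 * t - 12 * h + 11) (by omega) (by omega) rfl
        (by obtain ⟨c, hc⟩ := hev; exact ⟨7 * c - 2 * t - 4, by rw [hc]; ring⟩)
        (by linear_combination e)
      have key : ∀ x ∈ orbitTwoTwo,
          (7 * (x.1 + 8) + 4 * (x.2 - 11), 12 * (x.1 + 8) + 7 * (x.2 - 11)) ∈ orbitTwoTwo := by
        decide
      convert key _ this using 2
      · push_cast; ring
      · push_cast; ring

set_option maxRecDepth 4000 in
theorem solution_three {h t : ℤ} (ht : 0 ≤ t) (hh : 0 ≤ h) (hev : Even h)
    (e : t ^ 2 + 5 * t + 2 + h = 3 * h ^ 2 + 3 * h) :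
    3 ∣ h ^ 2 + h + 1 ∨ 7 ∣ h ^ 2 + h + 1 ∨ 7 ∣ h * (2 * (h ^ 2 + h) - t + 1) + 1 ∨
      (7 ∣ h + 1 ∧ 7 ∣ 2 * (h ^ 2 + h) - t + 1) := by
  -- In `ZMod 21`, `7x = 0` encodes `3 ∣ x` and `3x = 0` encodes `7 ∣ x`.
  have key : ∀ x ∈ orbitTwoTwo,
      7 * (x.1 ^ 2 + x.1 + 1) = 0 ∨ 3 * (x.1 ^ 2 + x.1 + 1) = 0 ∨
        3 * (x.1 * (2 * (x.1 ^ 2 + x.1) - x.2 + 1) + 1) = 0 ∨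
        (3 * (x.1 + 1) = 0 ∧ 3 * (2 * (x.1 ^ 2 + x.1) - x.2 + 1) = 0) := by
    decide
  have hmem := key _ (solution_three_mod _ h t hh ht rfl hev e)
  have cast0 : ∀ a : ℤ, (a : ZMod 21) = 0 → (21 : ℤ) ∣ a := fun a ha =>
    (ZMod.intCast_zmod_eq_zero_iff_dvd a 21).1 ha
  rcases hmem with h1 | h1 | h1 | ⟨h1, h2⟩
  · have := cast0 (7 * (h ^ 2 + h + 1)) (by push_cast; exact h1)
    omega
  · have := cast0 (3 * (h ^ 2 + h + 1)) (by push_cast; exact h1)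
    omega
  · have := cast0 (3 * (h * (2 * (h ^ 2 + h) - t + 1) + 1)) (by push_cast; exact h1)
    omega
  · have u1 := cast0 (3 * (h + 1)) (by push_cast; exact h1)
    have u2 := cast0 (3 * (2 * (h ^ 2 + h) - t + 1)) (by push_cast; exact h2)
    omega

/-! ### The analytic bound -/

/-- The bound `2y² - (√m - 1/2)y + (3m + 4 + (4 - m)/√m)/8`, with `s = √m`. -/
noncomputable def boundFun (s y : ℝ) : ℝ :=
  2 * y ^ 2 - (s - 1 / 2) * y + (3 * s ^ 2 + 4 + (4 - s ^ 2) / s) / 8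

theorem rpow_eighth_pow_eight {x : ℝ} (hx : 0 ≤ x) : (x ^ (1 / 8 : ℝ)) ^ 8 = x := by
  rw [← Real.rpow_natCast, ← Real.rpow_mul hx]
  norm_num

theorem sqrt_two_mul_rpow_quarter {x : ℝ} (hx : 0 ≤ x) :
    √2 * x ^ (1 / 4 : ℝ) = 2 * ((x / 4) ^ (1 / 8 : ℝ)) ^ 2 := by
  have hy : 0 ≤ (x / 4) ^ (1 / 8 : ℝ) := by positivity
  have h1 : (√2 * x ^ (1 / 4 : ℝ)) ^ 4 = 4 * x := by
    rw [mul_pow, ← Real.rpow_natCast (x ^ (1 / 4 : ℝ)), ← Real.rpow_mul hx,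
      show √2 ^ 4 = (√2 ^ 2) ^ 2 by ring, Real.sq_sqrt (by norm_num)]
    norm_num
  have h2 : (2 * ((x / 4) ^ (1 / 8 : ℝ)) ^ 2) ^ 4 = 4 * x := by
    have := rpow_eighth_pow_eight (show 0 ≤ x / 4 by positivity)
    linear_combination 16 * this
  exact (pow_left_inj₀ (by positivity) (by positivity) (by norm_num)).1 (h1.trans h2.symm)

theorem bound_three_eq {x : ℝ} (hx : 0 ≤ x) :
    √2 * x ^ (1 / 4 : ℝ) - (√3 - 1 / 2) * (x / 4) ^ (1 / 8 : ℝ) + (39 + √3) / 24 =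
      boundFun √3 ((x / 4) ^ (1 / 8 : ℝ)) := by
  have h3 : √3 ^ 2 = 3 := Real.sq_sqrt (by norm_num)
  have : (4 - 3) / √3 = √3 / 3 := by
    rw [div_eq_div_iff (by positivity) (by norm_num)]
    linarith
  rw [boundFun, sqrt_two_mul_rpow_quarter hx, h3, this]
  ring

theorem bound_seven_eq {x : ℝ} (hx : 0 ≤ x) :
    √2 * x ^ (1 / 4 : ℝ) - (√7 - 1 / 2) * (x / 4) ^ (1 / 8 : ℝ) + (175 - 3 * √7) / 56 =
      boundFun √7 ((x / 4) ^ (1 / 8 : ℝ)) := by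
  have h3 : √7 ^ 2 = 7 := Real.sq_sqrt (by norm_num)
  have : (4 - 7) / √7 = -3 * √7 / 7 := by
    rw [div_eq_div_iff (by positivity) (by norm_num)]
    linarith
  rw [boundFun, sqrt_two_mul_rpow_quarter hx, h3, this]
  ring

theorem sqrt_three_bounds : 1.732 < √3 ∧ √3 < 1.7321 :=
  ⟨Real.lt_sqrt_of_sq_lt (by norm_num), (Real.sqrt_lt' (by norm_num)).2 (by norm_num)⟩

theorem sqrt_seven_bounds : 2.6457 < √7 ∧ √7 < 2.6458 :=
  ⟨Real.lt_sqrt_of_sq_lt (by norm_num), (Real.sqrt_lt' (by norm_num)).2 (by norm_num)⟩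

theorem boundFun_three_le {y : ℝ} (hy : 3 / 2 ≤ y) : boundFun √7 y ≤ boundFun √3 y := by
  obtain ⟨a1, a2⟩ := sqrt_three_bounds
  obtain ⟨b1, b2⟩ := sqrt_seven_bounds
  have h3 : √3 ^ 2 = 3 := Real.sq_sqrt (by norm_num)
  have h7 : √7 ^ 2 = 7 := Real.sq_sqrt (by norm_num)
  have e3 : (0 : ℝ) < (4 - 3) / √3 := by positivity
  have e7 : (4 - 7 : ℝ) / √7 < -1.1 := by
    rw [div_lt_iff₀ (by positivity)]
    linarith
  rw [boundFun, boundFun, h3, h7]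
  nlinarith [mul_nonneg (sub_nonneg.2 hy) (by linarith : 0 ≤ √7 - √3 - 0.9)]

/-- The hypothesis says `b ≤ (8/5) y²`, and `boundFun √7 y - (8/5) y²` is a quadratic in `y` with
positive minimum, attained near `y = 2.68`. -/
theorem lt_boundFun_seven_of_pow_le {b n : ℝ} (hb : 0 ≤ b) (hn : 0 ≤ n)
    (h : 625 * b ^ 4 ≤ 1024 * n) : b < boundFun √7 ((n / 4) ^ (1 / 8 : ℝ)) := by
  set y := (n / 4) ^ (1 / 8 : ℝ) with hy
  have hy0 : 0 ≤ y := by positivity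
  have hy8 : y ^ 8 = n / 4 := rpow_eighth_pow_eight (by positivity)
  have h1 : b ≤ 8 / 5 * y ^ 2 := by
    refine (pow_le_pow_iff_left₀ hb (by positivity) (n := 4) (by norm_num)).1 ?_
    have : (8 / 5 * y ^ 2) ^ 4 = 4096 / 625 * y ^ 8 := by ring
    rw [this, hy8]
    linarith
  obtain ⟨b1, b2⟩ := sqrt_seven_bounds
  have h7 : √7 ^ 2 = 7 := Real.sq_sqrt (by norm_num)
  have e7 : (-1.134 : ℝ) < (4 - 7 : ℝ) / √7 := by
    rw [lt_div_iff₀ (by positivity)]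
    linarith
  rw [boundFun, h7]
  nlinarith [sq_nonneg (y - 2.68), mul_nonneg hy0 (sub_nonneg.2 b2.le)]

theorem boundFun_mono {s y z : ℝ} (hs : s ≤ 4) (hy : 1 ≤ y) (hyz : y ≤ z) :
    boundFun s y ≤ boundFun s z := by
  unfold boundFun
  nlinarith [mul_nonneg (sub_nonneg.2 hyz) (by linarith : (0 : ℝ) ≤ 2 * (y + z) - (s - 1 / 2))]

/-- `T` is the square root in the formulas `2(h² + h) + 2 + m/2 ∓ T` for the two larger cofactors
of an extremal triple; `w` is a lower bound for the coefficient of `1/h` in its expansion. -/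
theorem lt_boundFun_of_extremal {s w h T N : ℝ} (hs : 1 ≤ s) (hs4 : s ≤ 4) (hh : 1 ≤ h)
    (hT : 0 ≤ T) (hw : s * ((33 + 4 * s ^ 2) / 128) ≤ w)
    (hsq : (s * (h + (s ^ 2 - 1) / (2 * s ^ 2)) + w / (h + 1 / 2)) ^ 2 ≤ T ^ 2)
    (hN : 4 * (h + 3 / 8 + (33 + 4 * s ^ 2) / 128 / (h + 1 / 2)) ^ 8 ≤ N) :
    2 * (h ^ 2 + h) + 2 + s ^ 2 / 2 - T < boundFun s ((N / 4) ^ (1 / 8 : ℝ)) := by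
  set b := (33 + 4 * s ^ 2) / 128 with hb
  set y := h + 3 / 8 + b / (h + 1 / 2) with hy
  have hbpos : 0 < b := by positivity
  have hy1 : 1 ≤ y := by
    have : 0 ≤ b / (h + 1 / 2) := by positivity
    linarith
  have hyN : y ≤ (N / 4) ^ (1 / 8 : ℝ) := by
    have hN0 : 0 ≤ N := le_trans (by positivity) hN
    refine (pow_le_pow_iff_left₀ (by linarith) (by positivity) (n := 8) (by norm_num)).1 ?_
    rw [rpow_eighth_pow_eight (by positivity)]
    linarith
  refine lt_of_lt_of_le ?_ (boundFun_mono hs4 hy1 hyN)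
  have hTge := le_of_sq_le_sq hsq hT
  have hpos : 0 < (w - s * b) / (h + 1 / 2) + 2 * (b / (h + 1 / 2)) ^ 2 := by
    have : 0 ≤ w - s * b := by linarith
    positivity
  -- The coefficients of `boundFun` are such that everything cancels except these terms of order
  -- `1/h` and smaller.
  have key : boundFun s y - (2 * (h ^ 2 + h) + 2 + s ^ 2 / 2
      - (s * (h + (s ^ 2 - 1) / (2 * s ^ 2)) + w / (h + 1 / 2)))
      = (w - s * b) / (h + 1 / 2) + 2 * (b / (h + 1 / 2)) ^ 2 := by
    have hs0 : s ≠ 0 := by positivity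
    have hg : h + 1 / 2 ≠ 0 := by positivity
    have hg' : h * 2 + 1 ≠ 0 := by positivity
    rw [boundFun, hy, hb]
    field_simp
    ring
  linarith

/-- The product of an extremal triple, for real parameters. -/
noncomputable def extremalProduct (m h : ℝ) : ℝ :=
  (h ^ 2 + h + 1) * (h ^ 2 * (4 * (h ^ 2 + h) ^ 2 + (8 + m) * (h ^ 2 + h) + h + 5 + m)
    + h * (4 * (h ^ 2 + h) + 4 + m) + 1)

theorem extremalProduct_mono {m m' h : ℝ} (hh : 0 ≤ h) (hm : m ≤ m') :
    extremalProduct m h ≤ extremalProduct m' h := by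
  unfold extremalProduct
  gcongr

/-- The left side uses the expansion of the eighth root of `extremalProduct 3 h / 4`, exact through
order `1/h`. Shifting `h` by 2 makes the cleared difference a polynomial with nonnegative
coefficients. -/
theorem extremalProduct_three {h : ℝ} (hh : 2 ≤ h) :
    4 * (h + 3 / 8 + (33 + 4 * 3) / 128 / (h + 1 / 2)) ^ 8 ≤ extremalProduct 3 h := by
  obtain ⟨x, rfl⟩ : ∃ x, h = x + 2 := ⟨h - 2, by ring⟩
  have hx : 0 ≤ x := by linarith
  have : x + 2 + 3 / 8 + (33 + 4 * 3) / 128 / (x + 2 + 1 / 2) =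
      ((x + 2 + 3 / 8) * (x + 2 + 1 / 2) + (33 + 4 * 3) / 128) / (x + 2 + 1 / 2) := by
    field_simp
  rw [this, div_pow, mul_div_assoc', div_le_iff₀ (by positivity), extremalProduct, ← sub_nonneg]
  ring_nf
  positivity

theorem extremalProduct_seven {h : ℝ} (hh : 4 ≤ h) :
    4 * (h + 3 / 8 + (33 + 4 * 7) / 128 / (h + 1 / 2)) ^ 8 ≤ extremalProduct 7 h := by
  obtain ⟨x, rfl⟩ : ∃ x, h = x + 4 := ⟨h - 4, by ring⟩
  have hx : 0 ≤ x := by linarith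
  have : x + 4 + 3 / 8 + (33 + 4 * 7) / 128 / (x + 4 + 1 / 2) =
      ((x + 4 + 3 / 8) * (x + 4 + 1 / 2) + (33 + 4 * 7) / 128) / (x + 4 + 1 / 2) := by
    field_simp
  rw [this, div_pow, mul_div_assoc', div_le_iff₀ (by positivity), extremalProduct, ← sub_nonneg]
  ring_nf
  positivity

/-- `t` and `m` are tied to `h` by `m (h² + h - t) = (t + 1)² + h + 1`. -/
theorem extremalProduct_eq {m h t : ℝ} (e : m * (h ^ 2 + h - t) = (t + 1) ^ 2 + h + 1) :
    (h ^ 2 + h + 1) * (h * (2 * (h ^ 2 + h) - t + 1) + 1) * (h * (2 * (h ^ 2 + h) + t + 3 + m) + 1)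
      = extremalProduct m h := by
  unfold extremalProduct
  linear_combination (h ^ 2 + h + 1) * h ^ 2 * e

theorem lt_boundFun_three {m h t : ℝ} (hh : 2 ≤ h) (ht : 0 ≤ t) (htP : t ≤ h ^ 2 + h) (hm : 3 ≤ m)
    (e : m * (h ^ 2 + h - t) = (t + 1) ^ 2 + h + 1) :
    2 * (h ^ 2 + h) - t + 1 < boundFun √3 ((extremalProduct m h / 4) ^ (1 / 8 : ℝ)) := by
  have h3 : √3 ^ 2 = 3 := Real.sq_sqrt (by norm_num)
  obtain ⟨a1, a2⟩ := sqrt_three_bounds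
  -- As `h² + h - t ≥ 0`, `m` may be lowered to 3; this bounds `T = t + 5/2` from below.
  have hle : 3 * (h ^ 2 + h - t) ≤ (t + 1) ^ 2 + h + 1 := by nlinarith
  have := lt_boundFun_of_extremal (s := √3) (w := 1) (h := h) (T := t + 1 + 3 / 2)
    (N := extremalProduct m h) (by linarith) (by linarith) (by linarith) (by linarith)
    (by rw [h3]; linarith)
    (by
      rw [h3]
      have hg : 1 / (h + 1 / 2) ≤ 2 / 5 := by
        rw [div_le_div_iff₀ (by linarith) (by norm_num)]
        linarith
      have hg0 : 0 ≤ 1 / (h + 1 / 2) := by positivity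
      have hg1 : 1 / (h + 1 / 2) * (h + 1 / 2) = 1 := by field_simp
      set u := 1 / (h + 1 / 2)
      have : (√3 * (h + (3 - 1) / (2 * 3)) + u) ^ 2
          = 3 * (h + 1 / 3) ^ 2 + 2 * √3 * (1 - u / 6) + u ^ 2 := by
        linear_combination (h + 1 / 3) ^ 2 * h3 + 2 * √3 * hg1
      rw [this]
      nlinarith)
    (by rw [h3]; exact (extremalProduct_three hh).trans (extremalProduct_mono (by linarith) hm))
  rw [h3] at this
  linarith

theorem lt_boundFun_seven {m h t : ℝ} (hh : 4 ≤ h) (ht : 0 ≤ t) (htP : t ≤ h ^ 2 + h) (hm : 7 ≤ m)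
    (e : m * (h ^ 2 + h - t) = (t + 1) ^ 2 + h + 1) :
    2 * (h ^ 2 + h) - t + 1 < boundFun √7 ((extremalProduct m h / 4) ^ (1 / 8 : ℝ)) := by
  have h3 : √7 ^ 2 = 7 := Real.sq_sqrt (by norm_num)
  obtain ⟨a1, a2⟩ := sqrt_seven_bounds
  have hle : 7 * (h ^ 2 + h - t) ≤ (t + 1) ^ 2 + h + 1 := by nlinarith
  have := lt_boundFun_of_extremal (s := √7) (w := 2) (h := h) (T := t + 1 + 7 / 2)
    (N := extremalProduct m h) (by linarith) (by linarith) (by linarith) (by linarith)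
    (by rw [h3]; linarith)
    (by
      rw [h3]
      have hg : 1 / (h + 1 / 2) ≤ 2 / 5 := by
        rw [div_le_div_iff₀ (by linarith) (by norm_num)]
        linarith
      have hg0 : 0 ≤ 1 / (h + 1 / 2) := by positivity
      have hg1 : 1 / (h + 1 / 2) * (h + 1 / 2) = 1 := by field_simp
      rw [show 2 / (h + 1 / 2) = 2 * (1 / (h + 1 / 2)) by ring]
      set u := 1 / (h + 1 / 2)
      have : (√7 * (h + (7 - 1) / (2 * 7)) + 2 * u) ^ 2
          = 7 * (h + 3 / 7) ^ 2 + 4 * √7 * (1 - u / 14) + 4 * u ^ 2 := by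
        linear_combination (h + 3 / 7) ^ 2 * h3 + 4 * √7 * hg1
      rw [this]
      nlinarith)
    (by rw [h3]; exact (extremalProduct_seven hh).trans (extremalProduct_mono (by linarith) hm))
  rw [h3] at this
  linarith

/-! ### The cofactors of a Korselt triple -/

/-- The data attached to a Korselt triple `(p, q, r) = (HA + 1, HB + 1, HC + 1)`. -/
structure KorseltData (H A B C E k : ℕ) : Prop where
  even_H : Even H
  H_pos : 0 < H
  A_pos : 0 < A
  A_lt_B : A < B
  B_lt_C : B < C
  two_le_E : 2 ≤ E
  E_le : E ≤ H * A
  E_mul_C : E * C = H * A * B + A + B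
  coprime : Nat.Coprime A B
  k_mul_B : k * B = H * A + E + 1
  dvd : A ∣ H + k

/-- Multiplying the divisibilities by `E` eliminates `C`: modulo `B` what remains is `A (HA + E +
1)`, modulo `A` it is `B (HB + E + 1)`. Coprimality of `A` and `B` removes the outer factors. -/
theorem KorseltData.of_dvd {H A B C : ℕ} (hev : Even H) (hH : 0 < H) (hA : 0 < A) (hAB : A < B)
    (hBC : B < C) (hg : Nat.gcd A (Nat.gcd B C) = 1)
    (dA : A ∣ H * B * C + B + C) (dB : B ∣ H * A * C + A + C) {E : ℕ}
    (hE : 2 ≤ E) (hEC : E * C = H * A * B + A + B) : ∃ k, KorseltData H A B C E k := by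
  have hco : Nat.Coprime A B := by
    set d := Nat.gcd A B with hd
    have d1 : d ∣ A := Nat.gcd_dvd_left A B
    have d2 : d ∣ B := Nat.gcd_dvd_right A B
    have d3 : d ∣ H * B * C + B + C := d1.trans dA
    have d4 : d ∣ H * B * C + B :=
      dvd_add ((d2.mul_left H).mul_right C) d2
    have d5 : d ∣ C := (Nat.dvd_add_right d4).1 d3
    exact Nat.dvd_one.1 (hg ▸ Nat.dvd_gcd d1 (Nat.dvd_gcd d2 d5))
  have hEle : E ≤ H * A := by
    by_contra hlt
    have h1 : H * A + 1 ≤ E := by omega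
    have h2 : B + 1 ≤ C := hBC
    have h3 : A ≤ H * A := Nat.le_mul_of_pos_left A hH
    have := Nat.mul_le_mul h1 h2
    rw [hEC] at this
    nlinarith
  obtain ⟨k, hk⟩ : B ∣ H * A + E + 1 := by
    have h2 : B ∣ E * (H * A * C + A + C) := dB.mul_left E
    have h3 : E * (H * A * C + A + C) = B * ((H * A + 1) * (H * A + 1)) + A * (H * A + E + 1) := by
      linear_combination (H * A + 1) * hEC
    rw [h3] at h2
    exact (hco.symm).dvd_of_dvd_mul_left ((Nat.dvd_add_right (Dvd.intro _ rfl)).1 h2)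
  refine ⟨k, hev, hH, hA, hAB, hBC, hE, hEle, hEC, hco, by rw [hk, mul_comm], ?_⟩
  have h2 : A ∣ E * (H * B * C + B + C) := dA.mul_left E
  have h3 : E * (H * B * C + B + C) = A * ((H * B + 1) * (H * B + 1)) + B * (H * B + E + 1) := by
    linear_combination (H * B + 1) * hEC
  rw [h3] at h2
  have h4 : A ∣ H * B + E + 1 :=
    hco.dvd_of_dvd_mul_left ((Nat.dvd_add_right (Dvd.intro _ rfl)).1 h2)
  have h5 : A * H + (H * B + E + 1) = (H + k) * B := by
    linear_combination hk
  exact hco.dvd_of_dvd_mul_right (h5 ▸ dvd_add (Dvd.intro _ rfl) h4)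

theorem IsKorselt3.exists_data {p q r : ℕ} (h : IsKorselt3 p q r) :
    ∃ H A B C E k : ℕ, KorseltData H A B C E k ∧ p = H * A + 1 ∧ q = H * B + 1 ∧ r = H * C + 1 ∧
      korseltB p q r = B := by
  obtain ⟨h1, hpq, hqr, op, oq, or, dp, dq, dr, hE⟩ := h
  obtain ⟨H, hHdef⟩ : ∃ H, korseltH p q r = H := ⟨_, rfl⟩
  have hd1 : H ∣ p - 1 := hHdef ▸ Nat.gcd_dvd_left _ _
  have hd2 : H ∣ q - 1 := hHdef ▸ (Nat.gcd_dvd_right _ _).trans (Nat.gcd_dvd_left _ _)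
  have hd3 : H ∣ r - 1 := hHdef ▸ (Nat.gcd_dvd_right _ _).trans (Nat.gcd_dvd_right _ _)
  have hHpos : 0 < H := hHdef ▸ Nat.gcd_pos_of_pos_left _ (by omega)
  have hev : Even H := by
    rw [even_iff_two_dvd, ← hHdef]
    refine Nat.dvd_gcd ?_ (Nat.dvd_gcd ?_ ?_)
    · exact (Nat.Odd.sub_odd op odd_one).two_dvd
    · exact (Nat.Odd.sub_odd oq odd_one).two_dvd
    · exact (Nat.Odd.sub_odd or odd_one).two_dvd
  obtain ⟨A, hA⟩ := hd1
  obtain ⟨B, hB⟩ := hd2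
  obtain ⟨C, hC⟩ := hd3
  have hB' : korseltB p q r = B := by
    rw [korseltB, hHdef, hB, Nat.mul_div_cancel_left _ hHpos]
  have hg : Nat.gcd A (Nat.gcd B C) = 1 := by
    have : H * Nat.gcd A (Nat.gcd B C) = H * 1 := by
      rw [← Nat.gcd_mul_left, ← Nat.gcd_mul_left, ← hA, ← hB, ← hC, mul_one]
      exact hHdef
    exact Nat.eq_of_mul_eq_mul_left hHpos this
  obtain rfl : p = H * A + 1 := by omega
  obtain rfl : q = H * B + 1 := by omega
  obtain rfl : r = H * C + 1 := by omega
  have hApos : 0 < A := Nat.pos_of_ne_zero (by rintro rfl; simp at h1)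
  have hAB : A < B := lt_of_mul_lt_mul_left (by omega : H * A < H * B) (Nat.zero_le H)
  have hBC : B < C := lt_of_mul_lt_mul_left (by omega : H * B < H * C) (Nat.zero_le H)
  have cancel : ∀ X Y Z : ℕ, H * X + 1 - 1 ∣ (H * X + 1) * (H * Y + 1) * (H * Z + 1) - 1 →
      X ∣ H * Y * Z + Y + Z := by
    intro X Y Z hd
    have e1 : (H * X + 1) * (H * Y + 1) * (H * Z + 1) - 1
        = H * (X * ((H * Y + 1) * (H * Z + 1)) + (H * Y * Z + Y + Z)) := by
      rw [Nat.sub_eq_iff_eq_add (Nat.succ_le_of_lt (by positivity))]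
      ring
    rw [e1, Nat.add_sub_cancel] at hd
    exact (Nat.dvd_add_right (Dvd.intro _ rfl)).1 (Nat.dvd_of_mul_dvd_mul_left hHpos hd)
  have dA := cancel A B C dp
  have dB := cancel B A C (by
    rwa [show (H * B + 1) * (H * A + 1) * (H * C + 1) = (H * A + 1) * (H * B + 1) * (H * C + 1) by
      ring])
  have dC := cancel C A B (by
    rwa [show (H * C + 1) * (H * A + 1) * (H * B + 1) = (H * A + 1) * (H * B + 1) * (H * C + 1) by
      ring])
  obtain ⟨E, hEC⟩ := dC
  have hEE : korseltE (H * A + 1) (H * B + 1) (H * C + 1) = E := by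
    have e1 : (H * A + 1) * (H * B + 1) - 1 = (H * C) * E := by
      rw [mul_assoc, ← hEC, Nat.sub_eq_iff_eq_add (by nlinarith [Nat.zero_le (H * A)])]
      ring
    rw [korseltE, e1, Nat.add_sub_cancel, Nat.mul_div_cancel_left _ (by omega)]
  rw [hEE] at hE
  obtain ⟨k, hk⟩ := KorseltData.of_dvd hev hHpos hApos hAB hBC hg dA dB hE
    (by rw [hEC, mul_comm])
  exact ⟨H, A, B, C, E, k, hk, rfl, rfl, rfl, hB'⟩

theorem KorseltData.k_pos {H A B C E k : ℕ} (d : KorseltData H A B C E k) : 0 < k := by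
  refine Nat.pos_of_ne_zero ?_
  rintro rfl
  have := d.k_mul_B
  omega

/-- Outside the extremal case `k = 1`, `A = H + 1`, the product is large compared with `B ^ 4`. -/
theorem KorseltData.pow_le_of_le {H A B C E k : ℕ} (d : KorseltData H A B C E k)
    (h : 625 * (2 * (H * A) + 1) ≤ 512 * (k ^ 2 * H ^ 2)) :
    625 * B ^ 4 ≤ 1024 * ((H * A + 1) * (H * B + 1) * (H * C + 1)) := by
  obtain ⟨hev, hH, hA, hAB, hBC, hE, hEle, hEC, hco, hk, hdvd⟩ := d
  have hkpos : 0 < k := Nat.pos_of_ne_zero (by rintro rfl; omega)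
  have h1 : 625 * B ≤ 512 * (k * H ^ 2) := by
    refine Nat.le_of_mul_le_mul_left ?_ hkpos
    calc k * (625 * B) = 625 * (H * A + E + 1) := by rw [← hk]; ring
      _ ≤ 625 * (2 * (H * A) + 1) := by omega
      _ ≤ _ := h
      _ = _ := by ring
  calc 625 * B ^ 4 = 625 * B * B ^ 3 := by ring
    _ ≤ 512 * (k * H ^ 2) * B ^ 3 := Nat.mul_le_mul_right _ h1
    _ = 512 * ((k * B) * (H * B) * (H * B)) := by ring
    _ ≤ 512 * ((2 * (H * A + 1)) * (H * B + 1) * (H * C + 1)) := by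
      have : H * B ≤ H * C := Nat.mul_le_mul_left H hBC.le
      exact Nat.mul_le_mul_left _
        (Nat.mul_le_mul (Nat.mul_le_mul (by omega) (by omega)) (by omega))
    _ = _ := by ring

theorem KorseltData.pow_le_of_two_le {H A B C E k : ℕ} (d : KorseltData H A B C E k)
    (hk2 : 2 ≤ k) : 625 * B ^ 4 ≤ 1024 * ((H * A + 1) * (H * B + 1) * (H * C + 1)) := by
  apply d.pow_le_of_le
  have hA : A ≤ H + k := Nat.le_of_dvd (by have := d.H_pos; omega) d.dvd
  obtain ⟨c, hc⟩ := d.even_H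
  have hpos := d.H_pos
  by_cases hH : 4 ≤ H
  · have h1 : H * A ≤ H * (H + k) := Nat.mul_le_mul_left H hA
    have h2 : 4 * H ^ 2 ≤ k ^ 2 * H ^ 2 := Nat.mul_le_mul_right _ (by nlinarith)
    have h3 : 8 * (H * k) ≤ k ^ 2 * H ^ 2 := by
      have : 8 ≤ H * k := by nlinarith
      calc 8 * (H * k) ≤ (H * k) * (H * k) := Nat.mul_le_mul_right _ this
        _ = _ := by ring
    have h4 : 64 ≤ k ^ 2 * H ^ 2 := by nlinarith
    nlinarith
  · obtain rfl : H = 2 := by omega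
    by_cases hk3 : 3 ≤ k
    · nlinarith
    · obtain rfl : k = 2 := by omega
      have hA2 : A ≤ 2 := by
        by_contra hlt
        have hdvd := d.dvd
        have hA4 : A ≤ 4 := hA
        -- `A = 4` is too large for the general estimate, but no `E ≤ 8` then makes both `B` and `C`
        -- integral.
        obtain rfl : A = 4 := by
          have : A ≠ 3 := by rintro rfl; omega
          omega
        have hE := d.two_le_E
        have hE8 := d.E_le
        have hEC := d.E_mul_C
        have hB := d.k_mul_B
        have hE8' : E ≤ 8 := hE8
        interval_cases E <;> omega
      omega

theorem KorseltData.pow_le_of_one {H A B C E : ℕ} (d : KorseltData H A B C E 1)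
    (hAH : A ≠ H + 1) : 625 * B ^ 4 ≤ 1024 * ((H * A + 1) * (H * B + 1) * (H * C + 1)) := by
  obtain ⟨c, hc⟩ := d.even_H
  have hpos := d.H_pos
  -- `H + 1` is odd, so the cofactor `j ≠ 1` is at least 3.
  obtain ⟨j, hj⟩ := d.dvd
  have hj3 : 3 ≤ j := by
    have h0 : j ≠ 0 := by rintro rfl; omega
    have h1 : j ≠ 1 := by rintro rfl; omega
    have h2 : j ≠ 2 := by rintro rfl; omega
    omega
  have hA3 : 3 * A ≤ H + 1 := by rw [hj]; nlinarith
  have hApos := d.A_pos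
  by_cases hH : 6 ≤ H
  · apply d.pow_le_of_le
    nlinarith
  · obtain rfl : A = 1 := by omega
    obtain rfl | rfl : H = 2 ∨ H = 4 := by omega
    · have hE := d.two_le_E
      have hE8 := d.E_le
      have hEC := d.E_mul_C
      have hB := d.k_mul_B
      -- Only `561 = 3 · 11 · 17` escapes the general estimate.
      obtain rfl : E = 2 := by omega
      obtain rfl : B = 5 := by omega
      obtain rfl : C = 8 := by omega
      norm_num
    · exact d.pow_le_of_le (by norm_num)

/-- The parametrisation of the extremal triples. -/
theorem KorseltData.exists_extremal {H B C E : ℕ} (d : KorseltData H (H + 1) B C E 1) :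
    ∃ t m : ℤ, 0 ≤ t ∧ t + 2 ≤ (H : ℤ) ^ 2 + H ∧ 1 ≤ m ∧
      (B : ℤ) = 2 * ((H : ℤ) ^ 2 + H) - t + 1 ∧ (C : ℤ) = 2 * ((H : ℤ) ^ 2 + H) + t + 3 + m ∧
      m * ((H : ℤ) ^ 2 + H - t) = (t + 1) ^ 2 + H + 1 := by
  have h1 : (E : ℤ) ≤ H * (H + 1) := by exact_mod_cast d.E_le
  have h2 : (B : ℤ) = H * (H + 1) + E + 1 := by
    have := d.k_mul_B
    rw [one_mul] at this
    exact_mod_cast this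
  have h3 : (E : ℤ) * C = H * (H + 1) * B + (H + 1) + B := by exact_mod_cast d.E_mul_C
  have hE : (2 : ℤ) ≤ E := by exact_mod_cast d.two_le_E
  have key : ((C : ℤ) - 3 * (H ^ 2 + H) + E - 3) * E
      = ((H : ℤ) ^ 2 + H - E + 1) ^ 2 + H + 1 := by
    linear_combination h3 + (H * (H + 1) + 1 : ℤ) * h2
  -- `t` measures how far `E` falls short of its maximum `HA = H² + H`.
  refine ⟨(H : ℤ) ^ 2 + H - E, (C : ℤ) - 3 * (H ^ 2 + H) + E - 3, by linarith, by linarith, ?_,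
    by linarith, by ring, by linear_combination key⟩
  have : 0 < ((C : ℤ) - 3 * (H ^ 2 + H) + E - 3) * E := by
    rw [key]
    positivity
  exact Int.add_one_le_iff.2 (pos_of_mul_pos_left this (by linarith))

theorem extremal_three_le {h t m : ℤ} (hh : 0 ≤ h) (ht : 0 ≤ t) (hm : 1 ≤ m)
    (e : m * (h ^ 2 + h - t) = (t + 1) ^ 2 + h + 1) : 3 ≤ m := by
  by_contra hlt
  obtain rfl | rfl : m = 1 ∨ m = 2 := by omega
  · exact no_solution_one ht hh (by linear_combination -e)
  · exact no_solution_two h t (by linear_combination -e)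

/-- For `m = 3`, a factor 3 or 7 divides `p`, 7 divides `q`, or 7 divides both `A` and `B`; only `p
= 7` survives, giving `6601 = 7 · 23 · 41`. For `m = 4`, `q = 451 = 11 · 41` is composite. -/
theorem extremal_seven_le {H B C E : ℕ} (d : KorseltData H (H + 1) B C E 1) {t m : ℤ}
    (ht : 0 ≤ t) (hm : 3 ≤ m) (hB : (B : ℤ) = 2 * ((H : ℤ) ^ 2 + H) - t + 1)
    (hC : (C : ℤ) = 2 * ((H : ℤ) ^ 2 + H) + t + 3 + m)
    (e : m * ((H : ℤ) ^ 2 + H - t) = (t + 1) ^ 2 + H + 1)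
    (hp : (H * (H + 1) + 1).Prime) (hq : (H * B + 1).Prime)
    (hn : (H * (H + 1) + 1) * (H * B + 1) * (H * C + 1) ≠ 6601) : 7 ≤ m := by
  have hH0 : (0 : ℤ) ≤ H := Int.natCast_nonneg H
  have hev : Even (H : ℤ) := by exact_mod_cast d.even_H
  have hHpos := d.H_pos
  have hAB := d.A_lt_B
  by_contra hlt
  obtain rfl | rfl | rfl | rfl : m = 3 ∨ m = 4 ∨ m = 5 ∨ m = 6 := by omega
  · have hp7 : H ^ 2 + H + 1 ≠ 7 := by
      intro h7
      obtain rfl : H = 2 := by nlinarith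
      obtain rfl : t = 2 := by push_cast at e; nlinarith
      obtain rfl : B = 11 := by push_cast at hB; omega
      obtain rfl : C = 20 := by push_cast at hC; omega
      exact hn (by norm_num)
    have hp' : (H ^ 2 + H + 1).Prime := by
      rwa [show H ^ 2 + H + 1 = H * (H + 1) + 1 by ring]
    rcases solution_three ht hH0 hev (by linear_combination -e) with h | h | h | ⟨h, h'⟩
    · have h : 3 ∣ H ^ 2 + H + 1 := by exact_mod_cast h
      have := (Nat.prime_dvd_prime_iff_eq Nat.prime_three hp').1 h
      obtain ⟨c, hc⟩ := d.even_H
      have : 2 ≤ H := by omega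
      nlinarith
    · have h : 7 ∣ H ^ 2 + H + 1 := by exact_mod_cast h
      exact hp7 ((Nat.prime_dvd_prime_iff_eq (by norm_num) hp').1 h).symm
    · rw [← hB] at h
      have h : 7 ∣ H * B + 1 := by exact_mod_cast h
      have := (Nat.prime_dvd_prime_iff_eq (by norm_num) hq).1 h
      obtain ⟨c, hc⟩ := d.even_H
      have : 2 ≤ H := by omega
      nlinarith
    · rw [← hB] at h'
      have h1 : 7 ∣ H + 1 := by exact_mod_cast h
      have h2 : 7 ∣ B := by exact_mod_cast h'
      have := Nat.dvd_gcd h1 h2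
      rw [d.coprime] at this
      omega
  · obtain ⟨h6, rfl⟩ := solution_four ht hH0 (by linear_combination -e)
    obtain rfl : H = 6 := by exact_mod_cast h6
    obtain rfl : B = 75 := by push_cast at hB; omega
    norm_num at hq
  · exact no_solution_five H t (by linear_combination -e)
  · exact no_solution_six ht hH0 hev (by linear_combination -e)

/-! ### Carmichael numbers with three prime factors -/

theorem IsCarmichael.sub_one_dvd {n p : ℕ} (hn : IsCarmichael n) (hp : p.Prime) (hpn : p ∣ n) :
    p - 1 ∣ n - 1 := by
  have := Fact.mk hp
  obtain ⟨g, hg⟩ := IsCyclic.exists_generator (α := (ZMod p)ˣ)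
  have hcard : orderOf g = p - 1 := by
    rw [orderOf_eq_card_of_forall_mem_zpowers hg, Nat.card_eq_fintype_card, ZMod.card_units]
  rw [← hcard]
  apply orderOf_dvd_of_pow_eq_one
  have h1 : ((g : ZMod p).val : ℤ) ^ n ≡ ((g : ZMod p).val : ℤ) [ZMOD p] :=
    (hn.2.2 _).of_dvd (by exact_mod_cast hpn)
  have h2 : (g : ZMod p) ^ n = g := by
    have := (ZMod.intCast_eq_intCast_iff _ _ p).2 h1
    push_cast at this
    simpa using this
  have h3 : g ^ n = g := by
    ext
    push_cast
    exact h2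
  have h4 : g ^ (n - 1) * g = 1 * g := by
    rw [← pow_succ, Nat.sub_add_cancel hn.1.le, h3, one_mul]
  exact mul_right_cancel h4

theorem IsCarmichael.isKorselt3 {p q r : ℕ} (hp : p.Prime) (hq : q.Prime) (hr : r.Prime)
    (hpq : p < q) (hqr : q < r) (hn : IsCarmichael (p * q * r)) : IsKorselt3 p q r := by
  have dp := hn.sub_one_dvd hp ((Dvd.intro _ rfl).mul_right r)
  have dq := hn.sub_one_dvd hq ((Dvd.intro_left _ rfl).mul_right r)
  have dr := hn.sub_one_dvd hr (Dvd.intro_left _ rfl)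
  have hp2 := hp.two_le
  have oq : Odd q := hq.odd_of_ne_two (by omega)
  have or : Odd r := hr.odd_of_ne_two (by omega)
  have hpos : 1 ≤ p * q * r := hn.1.le
  have op : Odd p := by
    rw [← Nat.not_even_iff_odd]
    intro hev
    have h1 : Even (p * q * r - 1) :=
      even_iff_two_dvd.2 ((Nat.Odd.sub_odd oq odd_one).two_dvd.trans dq)
    have h2 : Even (p * q * r) := (hev.mul_right q).mul_right r
    have h3 := Nat.Even.sub_odd hpos h2 odd_one
    exact (Nat.not_even_iff_odd.2 h3) h1
  refine ⟨hp.one_lt, hpq, hqr, op, oq, or, dp, dq, dr, ?_⟩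
  have hpq1 : 1 < p * q := by nlinarith
  obtain ⟨E, hE⟩ : r - 1 ∣ p * q - 1 := by
    have e1 : p * q * r - 1 = p * q * (r - 1) + (p * q - 1) := by
      obtain ⟨s, rfl⟩ : ∃ s, r = s + 1 := ⟨r - 1, by omega⟩
      rw [Nat.add_sub_cancel, mul_add, mul_one]
      omega
    rw [e1] at dr
    exact (Nat.dvd_add_right (Dvd.intro_left _ rfl)).1 dr
  rw [korseltE, hE, Nat.mul_div_cancel_left _ (by omega)]
  have h0 : E ≠ 0 := by rintro rfl; omega
  have h1 : E ≠ 1 := by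
    rintro rfl
    have h : p * q = r := by omega
    rw [← h] at hr
    exact Nat.not_prime_mul hp.one_lt.ne' hq.one_lt.ne' hr
  omega

/-! ### Assembly of the two bounds -/

theorem KorseltData.lt_boundFun_or_extremal {H A B C E k : ℕ} (d : KorseltData H A B C E k) :
    (B : ℝ) < boundFun √7
      ((((H * A + 1) * (H * B + 1) * (H * C + 1) : ℕ) / 4 : ℝ) ^ (1 / 8 : ℝ)) ∨
      k = 1 ∧ A = H + 1 := by
  by_cases hcase : k = 1 ∧ A = H + 1
  · exact Or.inr hcase
  left
  have hmain : 625 * B ^ 4 ≤ 1024 * ((H * A + 1) * (H * B + 1) * (H * C + 1)) := by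
    by_cases hk : k = 1
    · subst hk
      exact d.pow_le_of_one (fun h => hcase ⟨rfl, h⟩)
    · exact d.pow_le_of_two_le (by have := d.k_pos; omega)
  exact lt_boundFun_seven_of_pow_le (Nat.cast_nonneg B) (Nat.cast_nonneg _)
    (by exact_mod_cast hmain)

theorem cast_extremal_product {H B C : ℕ} {t m : ℤ}
    (hB : (B : ℤ) = 2 * ((H : ℤ) ^ 2 + H) - t + 1)
    (hC : (C : ℤ) = 2 * ((H : ℤ) ^ 2 + H) + t + 3 + m)
    (e : m * ((H : ℤ) ^ 2 + H - t) = (t + 1) ^ 2 + H + 1) :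
    (((H * (H + 1) + 1) * (H * B + 1) * (H * C + 1) : ℕ) : ℝ) = extremalProduct m H := by
  have hB' : (B : ℝ) = 2 * ((H : ℝ) ^ 2 + H) - t + 1 := by exact_mod_cast hB
  have hC' : (C : ℝ) = 2 * ((H : ℝ) ^ 2 + H) + t + 3 + m := by exact_mod_cast hC
  rw [← extremalProduct_eq (m := (m : ℝ)) (t := (t : ℝ)) (by exact_mod_cast e)]
  push_cast
  rw [hB', hC']
  ring

theorem korseltB_lt_of_isKorselt3 {p q r : ℕ} (h : IsKorselt3 p q r) :
    (korseltB p q r : ℝ) < boundFun √3 (((p * q * r : ℕ) / 4 : ℝ) ^ (1 / 8 : ℝ)) := by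
  -- The least product `3 · 5 · 7` suffices for `y ≥ 3/2`, because `105/4 > (3/2)^8`.
  have h105 : 105 ≤ p * q * r := by
    obtain ⟨a, ha⟩ := h.odd_p
    obtain ⟨b, hb⟩ := h.odd_q
    obtain ⟨c, hc⟩ := h.odd_r
    have h1 := h.one_lt
    have h2 := h.p_lt_q
    have h3 := h.q_lt_r
    exact Nat.mul_le_mul (Nat.mul_le_mul (by omega : 3 ≤ p) (by omega : 5 ≤ q)) (by omega : 7 ≤ r)
  obtain ⟨H, A, B, C, E, k, d, rfl, rfl, rfl, hB⟩ := h.exists_data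
  rw [hB]
  obtain hlt | ⟨rfl, rfl⟩ := d.lt_boundFun_or_extremal
  · refine hlt.trans_le (boundFun_three_le ?_)
    refine (pow_le_pow_iff_left₀ (by norm_num) (by positivity) (n := 8) (by norm_num)).1 ?_
    rw [rpow_eighth_pow_eight (by positivity)]
    have : (105 : ℝ) ≤ ((H * A + 1) * (H * B + 1) * (H * C + 1) : ℕ) := by exact_mod_cast h105
    linarith
  · obtain ⟨t, m, ht, htP, hm, hB, hC, e⟩ := d.exists_extremal
    have hm3 := extremal_three_le (Int.natCast_nonneg H) ht hm e
    have hH2 : 2 ≤ H := by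
      obtain ⟨c, hc⟩ := d.even_H
      have := d.H_pos
      omega
    have hB' : (B : ℝ) = 2 * ((H : ℝ) ^ 2 + H) - t + 1 := by exact_mod_cast hB
    rw [cast_extremal_product hB hC e, hB']
    exact lt_boundFun_three (by exact_mod_cast hH2) (by exact_mod_cast ht)
      (by exact_mod_cast (by linarith : t ≤ (H : ℤ) ^ 2 + H)) (by exact_mod_cast hm3)
      (by exact_mod_cast e)

theorem korseltB_lt_of_isCarmichael {p q r : ℕ} (hp : p.Prime) (hq : q.Prime)
    (h : IsKorselt3 p q r) (hn : p * q * r ≠ 6601) :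
    (korseltB p q r : ℝ) < boundFun √7 (((p * q * r : ℕ) / 4 : ℝ) ^ (1 / 8 : ℝ)) := by
  obtain ⟨H, A, B, C, E, k, d, rfl, rfl, rfl, hB⟩ := h.exists_data
  rw [hB]
  obtain hlt | ⟨rfl, rfl⟩ := d.lt_boundFun_or_extremal
  · exact hlt
  · obtain ⟨t, m, ht, htP, hm, hB, hC, e⟩ := d.exists_extremal
    have hm3 := extremal_three_le (Int.natCast_nonneg H) ht hm e
    have hm7 := extremal_seven_le d ht hm3 hB hC e hp hq hn
    obtain ⟨c, hc⟩ := d.even_H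
    have hpos := d.H_pos
    by_cases hH4 : 4 ≤ H
    · have hB' : (B : ℝ) = 2 * ((H : ℝ) ^ 2 + H) - t + 1 := by exact_mod_cast hB
      rw [cast_extremal_product hB hC e, hB']
      exact lt_boundFun_seven (by exact_mod_cast hH4) (by exact_mod_cast ht)
        (by exact_mod_cast (by linarith : t ≤ (H : ℤ) ^ 2 + H)) (by exact_mod_cast hm7)
        (by exact_mod_cast e)
    -- The eighth-root estimate needs `H ≥ 4`; for `H = 2` only `8911 = 7 · 19 · 67` remains.
    · obtain rfl : H = 2 := by omega
      push_cast at htP hB hC e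
      have ht4 : 4 ≤ t := by nlinarith
      obtain rfl : t = 4 := by omega
      obtain rfl : B = 9 := by omega
      obtain rfl : C = 33 := by omega
      exact lt_boundFun_seven_of_pow_le (by norm_num) (by positivity) (by norm_num)

theorem theorem4p8 :
    (∀ p q r n : ℕ, IsKorselt3 p q r → n = p * q * r →
      (korseltB p q r : ℝ) <
        √2 * (n : ℝ) ^ (1 / 4 : ℝ) - (√3 - 1 / 2) * ((n : ℝ) / 4) ^ (1 / 8 : ℝ)
          + (39 + √3) / 24) ∧
    (∀ p q r n : ℕ, p.Prime → q.Prime → r.Prime → p < q → q < r → n = p * q * r →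
      IsCarmichael n → n ≠ 6601 →
      (korseltB p q r : ℝ) <
        √2 * (n : ℝ) ^ (1 / 4 : ℝ) - (√7 - 1 / 2) * ((n : ℝ) / 4) ^ (1 / 8 : ℝ)
          + (175 - 3 * √7) / 56) := by
  refine ⟨?_, ?_⟩
  · rintro p q r n h rfl
    rw [bound_three_eq (Nat.cast_nonneg _)]
    exact korseltB_lt_of_isKorselt3 h
  · rintro p q r n hp hq hr hpq hqr rfl hn h6601
    rw [bound_seven_eq (Nat.cast_nonneg _)]
    exact korseltB_lt_of_isCarmichael hp hq (hn.isKorselt3 hp hq hr hpq hqr) h6601
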